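/- For $X\subseteq\mathbb{R}^3$, the diameter graph $DG(X)$ is the simple graph with vertex set $X$ in which two different points $P,Q\in X$ are adjacent if and only if their Euclidean distance $PQ$ is the maximum of the set $\{RS : R,S\in X,\ R\neq S\}$ of distances between different points of $X$ (if this set has no maximum, $DG(X)$ has no edges). Then, for every $X\subseteq\mathbb{R}^3$, the graph $DG(X)$ does not contain two vertex-disjoint $5$-cycles. -/

import Mathlib

/-- The set `A(X)` of all distances between two different points of `X ⊆ ℝ^d`. -/
def distanceSet {d : ℕ} (X : Set (EuclideanSpace ℝ (Fin d))) : Set ℝ :=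
  {r | ∃ P ∈ X, ∃ Q ∈ X, P ≠ Q ∧ dist P Q = r}

/-- `D` is the diameter of `X ⊆ ℝ^d`, that is `D = max A(X)`. -/
def IsDiameter {d : ℕ} (X : Set (EuclideanSpace ℝ (Fin d))) (D : ℝ) : Prop :=
  IsGreatest (distanceSet X) D

/-- The diameter graph of `X ⊆ ℝ^d`: its vertices are the points of `X`, and two different points
are adjacent if their distance is the diameter of `X`. (If the set of distances has no maximum,
the graph has no edges.) -/
def diameterGraph {d : ℕ} (X : Set (EuclideanSpace ℝ (Fin d))) : SimpleGraph X where
  Adj P Q := P ≠ Q ∧ IsDiameter X (dist P Q)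
  symm := ⟨fun P Q h => ⟨h.1.symm, by rw [dist_comm]; exact h.2⟩⟩
  loopless := ⟨fun _ h => h.1 rfl⟩

-- More generally, any two odd cycles of a diameter graph in space share a vertex. Walk around an
-- odd cycle `x` and take the vectors `(-1)^i (x (i+1) - x i)`. Because of the signs, consecutive
-- ones are, up to a common sign, the two edge vectors leaving the shared vertex `x (i+1)`, and
-- because the length is odd the sequence ends at the negative of its start. So it traces a
-- noncontractible closed polygon in the projective plane, and two such polygons must meet
-- (`exists_crossProduct_eq_zero_of_antipodal`).
--
-- A meeting point means that the cone spanned by the two edges at a vertex `x` and the one at a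
-- vertex `y` of the other cycle contain parallel vectors. If the cycles are disjoint this is
-- impossible (`crossProduct_combination_ne_zero`). Equal directions are excluded by the bisecting
-- plane of `x` and `y`, opposite directions by an inequality obtained by averaging the four
-- distance bounds between the edges' far ends (`combination_ne_neg_smul`).

/-- The determinant of three vectors of `ℝ³`. -/
def det3 (a b c : Fin 3 → ℝ) : ℝ :=
  a 0 * (b 1 * c 2 - b 2 * c 1) - a 1 * (b 0 * c 2 - b 2 * c 0) + a 2 * (b 0 * c 1 - b 1 * c 0)

/-- The sign bit of a real number. -/
noncomputable def signBit (x : ℝ) : Bool := decide (x < 0)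

theorem signBit_neg {x : ℝ} (hx : x ≠ 0) : signBit (-x) = !signBit x := by
  rcases lt_or_gt_of_ne hx with h | h
  · simp [signBit, h, h.le]
  · simp [signBit, h, h.le]

theorem signBit_mul {x y : ℝ} (hx : x ≠ 0) (hy : y ≠ 0) :
    signBit (x * y) = (signBit x ^^ signBit y) := by
  rcases lt_or_gt_of_ne hx with h | h <;> rcases lt_or_gt_of_ne hy with h' | h'
  · simp [signBit, h, h', (mul_pos_of_neg_of_neg h h').le]
  · simp [signBit, h, h'.le, mul_neg_of_neg_of_pos h h']
  · simp [signBit, h.le, h', mul_neg_of_pos_of_neg h h']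
  · simp [signBit, h.not_gt, h'.not_gt, (mul_pos h h').not_gt]

theorem signBit_sub {x y : ℝ} (hx : x ≠ 0) (hy : y ≠ 0) (h : (signBit x ^^ signBit y) = true) :
    signBit (x - y) = signBit x := by
  rcases lt_or_gt_of_ne hx with h1 | h1 <;> rcases lt_or_gt_of_ne hy with h2 | h2
  · simp [signBit, h1, h2] at h
  · have : x - y < 0 := by linarith
    simp only [signBit, h1, this]
  · have : ¬ x - y < 0 := by linarith
    simp only [signBit, h1.not_gt, this]
  · simp [signBit, h1.not_gt, h2.not_gt] at h

theorem signBit_sum_eq_zero {x y z : ℝ} (hx : x ≠ 0) (hy : y ≠ 0) (hz : z ≠ 0)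
    (h : x + y + z = 0) : ((signBit x ^^ signBit y) || (signBit y ^^ signBit z)) = true := by
  rcases lt_or_gt_of_ne hx with h1 | h1 <;> rcases lt_or_gt_of_ne hy with h2 | h2 <;>
    rcases lt_or_gt_of_ne hz with h3 | h3 <;>
    first | (exfalso; linarith) | simp [signBit, h1, h2, h3, h1.le, h2.le, h3.le]

-- Crossing parity of polygons in the projective plane.

/-- The number of crossings, modulo 2, of the segment `a a'` with the segment `b b'` in the
projective plane, for vectors in general position. -/
noncomputable def crossing (a a' b b' : Fin 3 → ℝ) : ZMod 2 :=
  if ((signBit (det3 a b b') ^^ signBit (det3 a' b b')) &&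
    (signBit (det3 a a' b) ^^ signBit (det3 a a' b'))) = true then 1 else 0

/-- Whether the projective point `p` lies in the triangle `a b c`, for vectors in general
position. -/
noncomputable def inTriangle (a b c p : Fin 3 → ℝ) : ZMod 2 :=
  if ((signBit (det3 b c p) ^^ signBit (det3 a c p)) &&
    (signBit (det3 a c p) ^^ signBit (det3 a b p))) = true then 1 else 0

/-- Sign pattern behind `crossing_add_crossing`: `p`, `q` hold the signs of the barycentric
coordinates of two points and `m` those of their cross product. The first three hypotheses say that
a difference of terms of opposite sign has the sign of the first. The last two come from the cross
product being orthogonal to both factors, so that the three summands cannot all have one sign. -/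
theorem triangle_parity_bits : ∀ p1 p2 p3 q1 q2 q3 m1 m2 m3 : Bool,
    ((p2 ^^ q3 ^^ p3 ^^ q2) = true → m1 = (p2 ^^ q3)) →
    ((p3 ^^ q1 ^^ p1 ^^ q3) = true → m2 = (p3 ^^ q1)) →
    ((p1 ^^ q2 ^^ p2 ^^ q1) = true → m3 = (p1 ^^ q2)) →
    ((p1 ^^ m1 ^^ p2 ^^ m2) || (p2 ^^ m2 ^^ p3 ^^ m3)) = true →
    ((q1 ^^ m1 ^^ q2 ^^ m2) || (q2 ^^ m2 ^^ q3 ^^ m3)) = true →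
    (if ((m1 ^^ m2) && (p3 ^^ q3)) = true then (1 : ZMod 2) else 0) +
      (if ((m2 ^^ m3) && (p1 ^^ q1)) = true then 1 else 0) =
      (if ((m1 ^^ m3) && (p2 ^^ q2)) = true then 1 else 0) +
      (if ((!(p1 ^^ p2)) && (!(p2 ^^ p3))) = true then 1 else 0) +
      (if ((!(q1 ^^ q2)) && (!(q2 ^^ q3))) = true then 1 else 0) := by
  decide

/-- A segment crosses the boundary of a triangle with the parity of the number of its endpoints
inside. By Cramer's rule the determinants with `p` and `q` are barycentric coordinates up to the
factor `det3 a b c`. -/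
theorem crossing_add_crossing {a b c p q : Fin 3 → ℝ} (habc : det3 a b c ≠ 0)
    (hp1 : det3 b c p ≠ 0) (hp2 : det3 a c p ≠ 0) (hp3 : det3 a b p ≠ 0)
    (hq1 : det3 b c q ≠ 0) (hq2 : det3 a c q ≠ 0) (hq3 : det3 a b q ≠ 0)
    (ha : det3 a p q ≠ 0) (hb : det3 b p q ≠ 0) (hc : det3 c p q ≠ 0) :
    crossing a b p q + crossing b c p q =
      crossing a c p q + (inTriangle a b c p + inTriangle a b c q) := by
  have m1 : det3 a b c * det3 a p q =
      (-det3 a c p) * det3 a b q - det3 a b p * (-det3 a c q) := by simp only [det3]; ring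
  have m2 : det3 a b c * det3 b p q =
      det3 a b p * det3 b c q - det3 b c p * det3 a b q := by simp only [det3]; ring
  have m3 : det3 a b c * det3 c p q =
      det3 b c p * (-det3 a c q) - (-det3 a c p) * det3 b c q := by simp only [det3]; ring
  have s1 : det3 b c p * det3 a p q + (-det3 a c p) * det3 b p q + det3 a b p * det3 c p q = 0 := by
    simp only [det3]; ring
  have s2 : det3 b c q * det3 a p q + (-det3 a c q) * det3 b p q + det3 a b q * det3 c p q = 0 := by
    simp only [det3]; ring
  have hp2' := neg_ne_zero.2 hp2
  have hq2' := neg_ne_zero.2 hq2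
  have M1 := signBit_sub (mul_ne_zero hp2' hq3) (mul_ne_zero hp3 hq2')
  have M2 := signBit_sub (mul_ne_zero hp3 hq1) (mul_ne_zero hp1 hq3)
  have M3 := signBit_sub (mul_ne_zero hp1 hq2') (mul_ne_zero hp2' hq1)
  have S1 := signBit_sum_eq_zero (mul_ne_zero hp1 ha) (mul_ne_zero hp2' hb) (mul_ne_zero hp3 hc) s1
  have S2 := signBit_sum_eq_zero (mul_ne_zero hq1 ha) (mul_ne_zero hq2' hb) (mul_ne_zero hq3 hc) s2
  rw [← m1] at M1
  rw [← m2] at M2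
  rw [← m3] at M3
  simp only [signBit_mul, signBit_neg, hp1, hp2, hp2', hp3, hq1, hq2, hq2', hq3, ha, hb, hc, habc,
    ne_eq, not_false_eq_true] at M1 M2 M3 S1 S2
  simp only [crossing, inTriangle]
  have key := triangle_parity_bits (signBit (det3 b c p)) (!signBit (det3 a c p))
    (signBit (det3 a b p)) (signBit (det3 b c q)) (!signBit (det3 a c q)) (signBit (det3 a b q))
    (signBit (det3 a b c) ^^ signBit (det3 a p q)) (signBit (det3 a b c) ^^ signBit (det3 b p q))
    (signBit (det3 a b c) ^^ signBit (det3 c p q))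
  generalize signBit (det3 b c p) = p1 at *
  generalize signBit (det3 a c p) = p2 at *
  generalize signBit (det3 a b p) = p3 at *
  generalize signBit (det3 b c q) = q1 at *
  generalize signBit (det3 a c q) = q2 at *
  generalize signBit (det3 a b q) = q3 at *
  generalize signBit (det3 a p q) = n1 at *
  generalize signBit (det3 b p q) = n2 at *
  generalize signBit (det3 c p q) = n3 at *
  generalize signBit (det3 a b c) = n at *
  have e : ∀ x y : Bool, (!(x ^^ !y)) = (x ^^ y) := by decide
  have e' : ∀ x y : Bool, (!((!x) ^^ y)) = (x ^^ y) := by decide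
  have e1 : ∀ x y z : Bool, ((x ^^ y) ^^ (x ^^ z)) = (y ^^ z) := by decide
  have e2 : ∀ x y : Bool, ((!x) ^^ (!y)) = (x ^^ y) := by decide
  rw [e, e, e', e', e1, e1, e1, e2] at key
  rw [← add_assoc]
  apply key
  · intro h; apply M1; rw [← h]; cases p2 <;> cases q3 <;> cases p3 <;> cases q2 <;> rfl
  · intro h; apply M2; rw [← h]; cases p3 <;> cases q1 <;> cases p1 <;> cases q3 <;> rfl
  · intro h; apply M3; rw [← h]; cases p1 <;> cases q1 <;> cases p2 <;> cases q2 <;> rfl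
  · rw [← S1]; cases p1 <;> cases p2 <;> cases p3 <;> cases n1 <;> cases n2 <;> cases n3 <;>
      cases n <;> rfl
  · rw [← S2]; cases q1 <;> cases q2 <;> cases q3 <;> cases n1 <;> cases n2 <;> cases n3 <;>
      cases n <;> rfl

/-- The arcs from `a` to `c` and from `c` to `-a` form a whole projective line, so only the sides of
`p` and `q` relative to the plane of `a`, `c` matter. -/
theorem crossing_add_crossing_neg {a c p q : Fin 3 → ℝ} (ha : det3 a p q ≠ 0) :
    crossing a c p q + crossing c (-a) p q =
      (if signBit (det3 a c p) = true then 1 else 0) +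
      (if signBit (det3 a c q) = true then 1 else 0) := by
  have e : det3 (-a) p q = -det3 a p q := by simp only [det3, Pi.neg_apply]; ring
  have e1 : det3 c (-a) p = det3 a c p := by simp only [det3, Pi.neg_apply]; ring
  have e2 : det3 c (-a) q = det3 a c q := by simp only [det3, Pi.neg_apply]; ring
  simp only [crossing, e, e1, e2, signBit_neg ha]
  generalize signBit (det3 a c p) = x
  generalize signBit (det3 a c q) = y
  generalize signBit (det3 a p q) = z
  generalize signBit (det3 c p q) = w
  revert x y z w
  decide

theorem inTriangle_neg {a b c p : Fin 3 → ℝ} (h1 : det3 b c p ≠ 0) (h2 : det3 a c p ≠ 0)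
    (h3 : det3 a b p ≠ 0) : inTriangle a b c (-p) = inTriangle a b c p := by
  have e (x y : Fin 3 → ℝ) : det3 x y (-p) = -det3 x y p := by
    simp only [det3, Pi.neg_apply]; ring
  simp only [inTriangle, e, signBit_neg h1, signBit_neg h2, signBit_neg h3, Bool.not_xor_not]

theorem sum_range_add_succ_zmod_two (f : ℕ → ZMod 2) (m : ℕ) :
    ∑ j ∈ Finset.range m, (f j + f (j + 1)) = f 0 + f m := by
  induction m with
  | zero => simp [CharTwo.add_self_eq_zero]
  | succ k ih =>
    rw [Finset.sum_range_succ, ih]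
    linear_combination CharTwo.add_self_eq_zero (f k)

/-- Two polygons `a₀, …, aₙ, aₙ₊₁ = -a₀` and `b₀, …, bₘ = -b₀` in general position are closed
curves of the projective plane that cross an odd number of times. -/
theorem sum_crossing_eq_one (n m : ℕ) (a b : ℕ → Fin 3 → ℝ) (hn : 1 ≤ n)
    (ha : a (n + 1) = -a 0) (hb : b m = -b 0)
    (h1 : ∀ i, 1 ≤ i → i < n → det3 (a 0) (a i) (a (i + 1)) ≠ 0)
    (h2 : ∀ i k j, i < k → k ≤ n → j ≤ m → det3 (a i) (a k) (b j) ≠ 0)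
    (h3 : ∀ i j, i ≤ n → j < m → det3 (a i) (b j) (b (j + 1)) ≠ 0) :
    ∑ i ∈ Finset.range (n + 1), ∑ j ∈ Finset.range m,
      crossing (a i) (a (i + 1)) (b j) (b (j + 1)) = 1 := by
  -- Cutting off triangles at `a 0` replaces the path by its chord. The corrections telescope along
  -- `b` and cancel, since `inTriangle` does not distinguish `b m = -b 0` from `b 0`.
  have fan : ∀ k, 1 ≤ k → k ≤ n → ∑ i ∈ Finset.range k, ∑ j ∈ Finset.range m,
      crossing (a i) (a (i + 1)) (b j) (b (j + 1)) =
      ∑ j ∈ Finset.range m, crossing (a 0) (a k) (b j) (b (j + 1)) := by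
    intro k hk
    induction k, hk using Nat.le_induction with
    | base => simp
    | succ k hk ih =>
      intro hkn
      rw [Finset.sum_range_succ, ih (by omega), ← Finset.sum_add_distrib]
      have : ∀ j ∈ Finset.range m, crossing (a 0) (a k) (b j) (b (j + 1)) +
          crossing (a k) (a (k + 1)) (b j) (b (j + 1)) =
          crossing (a 0) (a (k + 1)) (b j) (b (j + 1)) +
          (inTriangle (a 0) (a k) (a (k + 1)) (b j) +
            inTriangle (a 0) (a k) (a (k + 1)) (b (j + 1))) := by
        intro j hj
        have hj := Finset.mem_range.1 hj
        apply crossing_add_crossing (h1 k hk (by omega)) <;>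
          first | (apply h2 <;> omega) | (apply h3 <;> omega)
      rw [Finset.sum_congr rfl this, Finset.sum_add_distrib,
        sum_range_add_succ_zmod_two (fun j => inTriangle (a 0) (a k) (a (k + 1)) (b j)), hb,
        inTriangle_neg, CharTwo.add_self_eq_zero, add_zero] <;>
        (apply h2 <;> omega)
  -- The chord and the last edge make up a full line. The side of `b j` changes an odd number of
  -- times, because `b 0` and `-b 0` are on opposite sides.
  rw [Finset.sum_range_succ, fan n hn le_rfl, ← Finset.sum_add_distrib]
  have : ∀ j ∈ Finset.range m, crossing (a 0) (a n) (b j) (b (j + 1)) +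
      crossing (a n) (a (n + 1)) (b j) (b (j + 1)) =
      (if signBit (det3 (a 0) (a n) (b j)) = true then 1 else 0) +
      (if signBit (det3 (a 0) (a n) (b (j + 1))) = true then 1 else 0) := by
    intro j hj
    have hj := Finset.mem_range.1 hj
    rw [ha]
    exact crossing_add_crossing_neg (h3 0 j (by omega) hj)
  rw [Finset.sum_congr rfl this, sum_range_add_succ_zmod_two
    (fun j => if signBit (det3 (a 0) (a n) (b j)) = true then 1 else 0), hb]
  have e : det3 (a 0) (a n) (-b 0) = -det3 (a 0) (a n) (b 0) := by
    simp only [det3, Pi.neg_apply]; ring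
  rw [e, signBit_neg (h2 0 n 0 (by omega) le_rfl (by omega))]
  cases signBit (det3 (a 0) (a n) (b 0)) <;> rfl
-- Perturbation to general position.
open Filter Topology in
-- The determinant is a cubic in `ε` with leading coefficient `det3 a' b' c'`, so it has finitely
-- many roots.
theorem eventually_det3_add_smul_ne_zero (a b c a' b' c' : Fin 3 → ℝ) (h : det3 a' b' c' ≠ 0) :
    ∀ᶠ ε : ℝ in 𝓝[≠] 0, det3 (a + ε • a') (b + ε • b') (c + ε • c') ≠ 0 := by
  let p : Polynomial ℝ := Polynomial.C (det3 a b c) +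
    Polynomial.C (det3 a' b c + det3 a b' c + det3 a b c') * Polynomial.X +
    Polynomial.C (det3 a' b' c + det3 a' b c' + det3 a b' c') * Polynomial.X ^ 2 +
    Polynomial.C (det3 a' b' c') * Polynomial.X ^ 3
  have hp : p ≠ 0 := by
    intro h0
    apply h
    have := congrArg (fun q => Polynomial.coeff q 3) h0
    simpa only [p, Polynomial.coeff_add, Polynomial.coeff_C_mul, Polynomial.coeff_X_pow,
      Polynomial.coeff_X, Polynomial.coeff_C, Polynomial.coeff_zero, OfNat.ofNat_ne_zero,
      OfNat.one_ne_ofNat, Nat.reduceEqDiff, if_false, if_true, mul_zero, mul_one, zero_add]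
      using this
  have he (ε : ℝ) : det3 (a + ε • a') (b + ε • b') (c + ε • c') = p.eval ε := by
    simp only [p, Polynomial.eval_add, Polynomial.eval_mul, Polynomial.eval_C, Polynomial.eval_X,
      Polynomial.eval_pow, det3, Pi.add_apply, Pi.smul_apply, smul_eq_mul]
    ring
  simp only [he]
  have hfin : Set.Finite {x | p.IsRoot x} := Polynomial.finite_setOfPred_isRoot hp
  have h2 : ({x | p.IsRoot x} \ {0})ᶜ ∈ 𝓝 (0 : ℝ) :=
    (hfin.sdiff).isClosed.isOpen_compl.mem_nhds (by simp)
  filter_upwards [mem_nhdsWithin_of_mem_nhds h2, self_mem_nhdsWithin] with x hx hx0 hr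
  exact hx ⟨hr, hx0⟩

theorem exists_crossProduct_eq_zero_of_crossing {a a' b b' : Fin 3 → ℝ}
    (ha : det3 a b b' ≠ 0) (ha' : det3 a' b b' ≠ 0) (hb : det3 a a' b ≠ 0)
    (hb' : det3 a a' b' ≠ 0) (h : crossing a a' b b' ≠ 0) :
    ∃ s ∈ Set.Icc (0 : ℝ) 1, ∃ t ∈ Set.Icc (0 : ℝ) 1,
      crossProduct ((1 - s) • a + s • a') ((1 - t) • b + t • b') = 0 := by
  have weight {x y : ℝ} (hx : x ≠ 0) (hy : y ≠ 0) (hxy : (signBit x ^^ signBit y) = true) :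
      y - x ≠ 0 ∧ -x / (y - x) ∈ Set.Icc (0 : ℝ) 1 := by
    rcases lt_or_gt_of_ne hx with h1 | h1 <;> rcases lt_or_gt_of_ne hy with h2 | h2
    · simp [signBit, h1, h2] at hxy
    · have : 0 < y - x := by linarith
      refine ⟨this.ne', div_nonneg (by linarith) this.le, ?_⟩
      rw [div_le_one this]; linarith
    · have : y - x < 0 := by linarith
      refine ⟨this.ne, div_nonneg_of_nonpos (by linarith) this.le, ?_⟩
      rw [div_le_one_of_neg this]; linarith
    · simp [signBit, h1.not_gt, h2.not_gt] at hxy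
  have hc : ((signBit (det3 a b b') ^^ signBit (det3 a' b b')) &&
    (signBit (det3 a a' b) ^^ signBit (det3 a a' b'))) = true := by
    by_contra hc
    exact h (by rw [crossing, if_neg hc])
  rw [Bool.and_eq_true] at hc
  obtain ⟨hs, hs'⟩ := weight ha ha' hc.1
  obtain ⟨ht, ht'⟩ := weight hb hb' hc.2
  refine ⟨_, hs', _, ht', ?_⟩
  set x := det3 a b b' with hx
  set y := det3 a' b b' with hy
  set z := det3 a a' b with hz
  set w := det3 a a' b' with hw
  have e1 : (1 - -x / (y - x)) • a + (-x / (y - x)) • a' = (y - x)⁻¹ • (y • a - x • a') := by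
    ext i
    simp only [Pi.add_apply, Pi.smul_apply, smul_eq_mul, Pi.sub_apply]
    field_simp
    ring
  have e2 : (1 - -z / (w - z)) • b + (-z / (w - z)) • b' = (w - z)⁻¹ • (w • b - z • b') := by
    ext i
    simp only [Pi.add_apply, Pi.smul_apply, smul_eq_mul, Pi.sub_apply]
    field_simp
    ring
  -- The linear relation among four vectors of space: both sides lie on the line where the planes of
  -- `a`, `a'` and `b`, `b'` meet.
  have e3 : w • b - z • b' = -(y • a - x • a') := by
    ext i
    simp only [Pi.smul_apply, smul_eq_mul, Pi.sub_apply, Pi.neg_apply, hx, hy, hz, hw, det3]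
    fin_cases i <;> simp only [Fin.zero_eta, Fin.mk_one, Fin.reduceFinMk] <;> ring
  rw [e1, e2, e3]
  simp only [LinearMap.map_smul, LinearMap.smul_apply, LinearMap.map_neg, cross_self, neg_zero,
    smul_zero]

/-- The point `(1, t, t²)` of the moment curve. -/
def momentPoint (t : ℝ) : Fin 3 → ℝ := ![1, t, t ^ 2]

theorem det3_momentPoint (r s t : ℝ) :
    det3 (momentPoint r) (momentPoint s) (momentPoint t) = (s - r) * (t - r) * (t - s) := by
  simp [det3, momentPoint]
  ring

theorem det3_momentPoint_ne_zero {i j k : ℕ} (hij : i ≠ j) (hik : i ≠ k) (hjk : j ≠ k) :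
    det3 (momentPoint i) (momentPoint j) (momentPoint k) ≠ 0 := by
  rw [det3_momentPoint]
  have h1 : (i : ℝ) ≠ j := by exact_mod_cast hij
  have h2 : (i : ℝ) ≠ k := by exact_mod_cast hik
  have h3 : (j : ℝ) ≠ k := by exact_mod_cast hjk
  exact mul_ne_zero (mul_ne_zero (sub_ne_zero.2 h1.symm) (sub_ne_zero.2 h2.symm))
    (sub_ne_zero.2 h3.symm)

theorem det3_neg_right (a b c : Fin 3 → ℝ) : det3 a b (-c) = -det3 a b c := by
  simp only [det3, Pi.neg_apply]; ring

open Filter Topology in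
/-- Two closed polygons of the projective plane that lift to paths between antipodal points
have a common point. -/
theorem exists_crossProduct_eq_zero_of_antipodal (n m : ℕ) (a b : ℕ → Fin 3 → ℝ) (hn : 1 ≤ n)
    (hm : 2 ≤ m) (ha : a (n + 1) = -a 0) (hb : b m = -b 0) :
    ∃ i < n + 1, ∃ j < m, ∃ s ∈ Set.Icc (0 : ℝ) 1, ∃ t ∈ Set.Icc (0 : ℝ) 1,
      crossProduct ((1 - s) • a i + s • a (i + 1)) ((1 - t) • b j + t • b (j + 1)) = 0 := by
  by_contra hcon
  push Not at hcon
  -- The perturbing directions have distinct parameters on the moment curve, apart from the final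
  -- terms, which are negated starting points so that the perturbed polygons still close up
  -- antipodally.
  let a' : ℕ → Fin 3 → ℝ := fun i => if i = n + 1 then -momentPoint (0 : ℕ) else momentPoint i
  let b' : ℕ → Fin 3 → ℝ := fun j => if j = m then -momentPoint (n + 1 : ℕ)
    else momentPoint (n + 1 + j : ℕ)
  have ha' (i : ℕ) (hi : i ≤ n) : a' i = momentPoint i := if_neg (by omega)
  have hb' (j : ℕ) (hj : j < m) : b' j = momentPoint (n + 1 + j : ℕ) := if_neg (by omega)
  have hbm : b' m = -momentPoint (n + 1 : ℕ) := if_pos rfl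
  have g1 : ∀ i, 1 ≤ i → i < n → det3 (a' 0) (a' i) (a' (i + 1)) ≠ 0 := by
    intro i h1 h2
    rw [ha' 0 (by omega), ha' i (by omega), ha' (i + 1) (by omega)]
    apply det3_momentPoint_ne_zero <;> omega
  have g2 : ∀ i k j, i < k → k ≤ n → j ≤ m → det3 (a' i) (a' k) (b' j) ≠ 0 := by
    intro i k j h1 h2 h3
    rw [ha' i (by omega), ha' k (by omega)]
    rcases h3.lt_or_eq with h3 | rfl
    · rw [hb' j h3]
      apply det3_momentPoint_ne_zero <;> omega
    · rw [hbm, det3_neg_right, neg_ne_zero]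
      apply det3_momentPoint_ne_zero <;> omega
  have g3 : ∀ i j, i ≤ n → j < m → det3 (a' i) (b' j) (b' (j + 1)) ≠ 0 := by
    intro i j h1 h2
    rw [ha' i (by omega), hb' j h2]
    rcases (Nat.succ_le_of_lt h2).lt_or_eq with h3 | h3
    · rw [hb' (j + 1) h3]
      apply det3_momentPoint_ne_zero <;> omega
    · rw [show j + 1 = m from h3, hbm, det3_neg_right, neg_ne_zero]
      apply det3_momentPoint_ne_zero <;> omega
  have E1 : ∀ᶠ ε : ℝ in 𝓝[≠] 0, ∀ i ∈ Set.Iio n, 1 ≤ i →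
      det3 (a 0 + ε • a' 0) (a i + ε • a' i) (a (i + 1) + ε • a' (i + 1)) ≠ 0 := by
    rw [eventually_all_finite (Set.finite_Iio n)]
    intro i hi
    by_cases h : 1 ≤ i
    · filter_upwards [eventually_det3_add_smul_ne_zero _ _ _ _ _ _ (g1 i h hi)] with ε hε _
      exact hε
    · exact Eventually.of_forall fun ε h' => absurd h' h
  have E2 : ∀ᶠ ε : ℝ in 𝓝[≠] 0, ∀ k ∈ Set.Iic n, ∀ i ∈ Set.Iio k, ∀ j ∈ Set.Iic m,
      det3 (a i + ε • a' i) (a k + ε • a' k) (b j + ε • b' j) ≠ 0 := by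
    rw [eventually_all_finite (Set.finite_Iic n)]
    intro k hk
    rw [eventually_all_finite (Set.finite_Iio k)]
    intro i hi
    rw [eventually_all_finite (Set.finite_Iic m)]
    exact fun j hj => eventually_det3_add_smul_ne_zero _ _ _ _ _ _ (g2 i k j hi hk hj)
  have E3 : ∀ᶠ ε : ℝ in 𝓝[≠] 0, ∀ i ∈ Set.Iic n, ∀ j ∈ Set.Iio m,
      det3 (a i + ε • a' i) (b j + ε • b' j) (b (j + 1) + ε • b' (j + 1)) ≠ 0 := by
    rw [eventually_all_finite (Set.finite_Iic n)]
    intro i hi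
    rw [eventually_all_finite (Set.finite_Iio m)]
    exact fun j hj => eventually_det3_add_smul_ne_zero _ _ _ _ _ _ (g3 i j hi hj)
  -- Not meeting is an open condition, uniform over the compact square of parameters, so it survives
  -- a small perturbation.
  have E4 : ∀ᶠ ε : ℝ in 𝓝[≠] 0, ∀ i ∈ Set.Iio (n + 1), ∀ j ∈ Set.Iio m,
      ∀ x ∈ Set.Icc (0 : ℝ) 1 ×ˢ Set.Icc (0 : ℝ) 1,
      crossProduct ((1 - x.1) • (a i + ε • a' i) + x.1 • (a (i + 1) + ε • a' (i + 1)))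
        ((1 - x.2) • (b j + ε • b' j) + x.2 • (b (j + 1) + ε • b' (j + 1))) ≠ 0 := by
    rw [eventually_all_finite (Set.finite_Iio _)]
    intro i hi
    rw [eventually_all_finite (Set.finite_Iio m)]
    intro j hj
    apply Filter.Eventually.filter_mono nhdsWithin_le_nhds
    apply (isCompact_Icc.prod isCompact_Icc).eventually_forall_of_forall_eventually
    intro x hx
    have hcont : Continuous fun z : ℝ × (ℝ × ℝ) =>
        crossProduct ((1 - z.2.1) • (a i + z.1 • a' i) + z.2.1 • (a (i + 1) + z.1 • a' (i + 1)))
        ((1 - z.2.2) • (b j + z.1 • b' j) + z.2.2 • (b (j + 1) + z.1 • b' (j + 1))) := by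
      simp only [cross_apply]
      refine continuous_pi fun k => ?_
      fin_cases k <;> simp <;> fun_prop
    apply hcont.continuousAt.eventually_ne
    simpa using hcon i hi j hj x.1 hx.1 x.2 hx.2
  obtain ⟨ε, e1, e2, e3, e4⟩ := (E1.and (E2.and (E3.and E4))).exists
  have key := sum_crossing_eq_one n m (fun i => a i + ε • a' i) (fun j => b j + ε • b' j) hn
    (by simp [ha, a', add_comm]) (by
      have : (0 : ℕ) ≠ m := by omega
      simp [hb, b', this, add_comm])
    (fun i h1 h2 => e1 i h2 h1) (fun i k j h1 h2 h3 => e2 k h2 i h1 j h3)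
    (fun i j h1 h2 => e3 i h1 j h2)
  have hne : ∑ i ∈ Finset.range (n + 1), ∑ j ∈ Finset.range m,
      crossing (a i + ε • a' i) (a (i + 1) + ε • a' (i + 1)) (b j + ε • b' j)
        (b (j + 1) + ε • b' (j + 1)) ≠ 0 := by
    rw [key]; exact one_ne_zero
  obtain ⟨i, hi, hne⟩ := Finset.exists_ne_zero_of_sum_ne_zero hne
  obtain ⟨j, hj, hne⟩ := Finset.exists_ne_zero_of_sum_ne_zero hne
  have hi := Finset.mem_range.1 hi
  have hj := Finset.mem_range.1 hj
  have haε : a (n + 1) + ε • a' (n + 1) = -(a 0 + ε • a' 0) := by simp [ha, a', add_comm]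
  have D1 : ∀ i ≤ n + 1, det3 (a i + ε • a' i) (b j + ε • b' j)
      (b (j + 1) + ε • b' (j + 1)) ≠ 0 := by
    intro i hi
    rcases hi.lt_or_eq with h | rfl
    · exact e3 i (Nat.le_of_lt_succ h) j hj
    · have := e3 0 (Nat.zero_le n) j hj
      rw [haε]
      contrapose! this
      rw [← neg_eq_zero, ← this]
      simp only [det3, Pi.neg_apply]; ring
  have D2 : ∀ j ≤ m, det3 (a i + ε • a' i) (a (i + 1) + ε • a' (i + 1)) (b j + ε • b' j) ≠ 0 := by
    intro j hj
    rcases (Nat.succ_le_of_lt hi).lt_or_eq with h | h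
    · exact e2 (i + 1) (Nat.le_of_lt_succ h) i (Nat.lt_succ_self i) j hj
    · obtain rfl : i = n := by simpa using h
      have := e2 i (Set.mem_Iic.2 le_rfl) 0 hn j hj
      rw [haε]
      contrapose! this
      rw [← this]
      simp only [det3, Pi.neg_apply]; ring
  obtain ⟨s, hs, t, ht, h0⟩ := exists_crossProduct_eq_zero_of_crossing (D1 i hi.le) (D1 (i + 1) hi)
    (D2 j hj.le) (D2 (j + 1) hj) hne
  exact e4 i hi j hj (s, t) ⟨hs, ht⟩ h0
-- Cones spanned by diameters at two points.
section
variable {E : Type*} [NormedAddCommGroup E] [InnerProductSpace ℝ E]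
open scoped RealInnerProductSpace

/-- `z` is no nearer to `x` than to `y`, so it lies on the side of `y` of the bisecting plane, or on
that plane. -/
theorem inner_sub_neg_of_dist_le {x y z : E} {D : ℝ} (hxy : x ≠ y) (hz : dist z x = D)
    (h : dist z y ≤ D) : ⟪z - x, x - y⟫ < 0 := by
  have h1 : ‖z - y‖ ^ 2 ≤ ‖z - x‖ ^ 2 := by
    rw [← dist_eq_norm, ← dist_eq_norm, hz]
    exact pow_le_pow_left₀ dist_nonneg h 2
  have h2 : z - y = (z - x) + (x - y) := by abel
  rw [h2, norm_add_sq_real] at h1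
  have : 0 < ‖x - y‖ := norm_pos_iff.2 (sub_ne_zero.2 hxy)
  have := pow_pos this 2
  linarith

theorem inner_combination_neg {u v w : E} {s : ℝ} (hs : s ∈ Set.Icc (0 : ℝ) 1)
    (hu : ⟪u, w⟫ < 0) (hv : ⟪v, w⟫ < 0) : ⟪(1 - s) • u + s • v, w⟫ < 0 := by
  rw [inner_add_left, real_inner_smul_left, real_inner_smul_left]
  rcases hs.1.lt_or_eq with h | h
  · nlinarith [mul_nonneg (sub_nonneg.2 hs.2) (neg_nonneg.2 hu.le), mul_neg_of_pos_of_neg h hv]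
  · subst h; simpa using hu

theorem norm_combination_sq {u v : E} {D : ℝ} (s : ℝ) (hu : ‖u‖ = D) (hv : ‖v‖ = D) :
    ‖(1 - s) • u + s • v‖ ^ 2 = D ^ 2 - s * (1 - s) * ‖u - v‖ ^ 2 := by
  rw [norm_add_sq_real, norm_sub_sq_real, norm_smul, norm_smul, real_inner_smul_left,
    real_inner_smul_right, mul_pow, mul_pow, Real.norm_eq_abs, Real.norm_eq_abs, sq_abs, sq_abs,
    hu, hv]
  ring

theorem norm_combination_le {u v : E} {D s : ℝ} (hs : s ∈ Set.Icc (0 : ℝ) 1) (hu : ‖u‖ = D)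
    (hv : ‖v‖ = D) : ‖(1 - s) • u + s • v‖ ≤ D := by
  apply le_of_sq_le_sq _ (hu ▸ norm_nonneg u)
  rw [norm_combination_sq s hu hv]
  nlinarith [mul_nonneg (mul_nonneg hs.1 (sub_nonneg.2 hs.2)) (sq_nonneg ‖u - v‖)]

theorem combination_eq_or_eq {u v : E} {D s : ℝ} (huv : u ≠ v) (hu : ‖u‖ = D) (hv : ‖v‖ = D)
    (h : ‖(1 - s) • u + s • v‖ = D) : (1 - s) • u + s • v = u ∨ (1 - s) • u + s • v = v := by
  have h1 := norm_combination_sq s hu hv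
  have h2 : ‖u - v‖ ^ 2 ≠ 0 := pow_ne_zero 2 (norm_ne_zero_iff.2 (sub_ne_zero.2 huv))
  rw [h] at h1
  have h3 : s * (1 - s) * ‖u - v‖ ^ 2 = 0 := by linarith
  rcases mul_eq_zero.1 ((mul_eq_zero.1 h3).resolve_right h2) with h4 | h4
  · left; simp [h4]
  · right
    have : s = 1 := by linarith
    simp [this]

theorem eq_of_norm_of_le_inner {u d : E} {D : ℝ} (hu : ‖u‖ = D) (hd : ‖d‖ = D)
    (h : D ^ 2 ≤ ⟪u, d⟫) : u = d := by
  have h1 := norm_sub_sq_real u d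
  rw [hu, hd] at h1
  have h2 : ‖u - d‖ ^ 2 = 0 := le_antisymm (by linarith) (sq_nonneg _)
  exact sub_eq_zero.1 (norm_eq_zero.1 (pow_eq_zero_iff two_ne_zero |>.1 h2))

/-- If `u₁, u₂` and `v₁, v₂` are vectors of length `D` from the origin and from `d` to points at
mutual distance at most `D`, then the cones of `u₁, u₂` and of `-v₁, -v₂` meet only when one of
these points is `d` or the origin. -/
theorem combination_ne_neg_smul {u₁ u₂ v₁ v₂ d : E} {D s t l : ℝ} (hD : 0 < D)
    (hs : s ∈ Set.Icc (0 : ℝ) 1) (ht : t ∈ Set.Icc (0 : ℝ) 1) (hl : 0 < l)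
    (hu₁ : ‖u₁‖ = D) (hu₂ : ‖u₂‖ = D) (hv₁ : ‖v₁‖ = D) (hv₂ : ‖v₂‖ = D) (hd : ‖d‖ ≤ D)
    (h₁₁ : ‖u₁ - v₁ - d‖ ≤ D) (h₁₂ : ‖u₁ - v₂ - d‖ ≤ D) (h₂₁ : ‖u₂ - v₁ - d‖ ≤ D)
    (h₂₂ : ‖u₂ - v₂ - d‖ ≤ D) (hu : u₁ ≠ u₂) (hv : v₁ ≠ v₂) (hu₁d : u₁ ≠ d) (hu₂d : u₂ ≠ d)
    (hv₁d : -v₁ ≠ d) (hv₂d : -v₂ ≠ d) (h0 : (1 - s) • u₁ + s • u₂ ≠ 0) :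
    (1 - s) • u₁ + s • u₂ ≠ -(l • ((1 - t) • v₁ + t • v₂)) := by
  intro heq
  have bound {u v : E} (hu : ‖u‖ = D) (hv : ‖v‖ = D) (h : ‖u - v - d‖ ≤ D) :
      D ^ 2 + ‖d‖ ^ 2 - 2 * ⟪u, v⟫ - 2 * ⟪u, d⟫ + 2 * ⟪v, d⟫ ≤ 0 := by
    have h' := pow_le_pow_left₀ (norm_nonneg _) h 2
    rw [norm_sub_sq_real, norm_sub_sq_real, inner_sub_left, hu, hv] at h'
    linarith
  have b₁₁ := mul_nonneg (mul_nonneg (sub_nonneg.2 hs.2) (sub_nonneg.2 ht.2))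
    (neg_nonneg.2 (bound hu₁ hv₁ h₁₁))
  have b₁₂ := mul_nonneg (mul_nonneg (sub_nonneg.2 hs.2) ht.1) (neg_nonneg.2 (bound hu₁ hv₂ h₁₂))
  have b₂₁ := mul_nonneg (mul_nonneg hs.1 (sub_nonneg.2 ht.2)) (neg_nonneg.2 (bound hu₂ hv₁ h₂₁))
  have b₂₂ := mul_nonneg (mul_nonneg hs.1 ht.1) (neg_nonneg.2 (bound hu₂ hv₂ h₂₂))
  have hPn := norm_combination_le hs hu₁ hu₂
  have hQn := norm_combination_le ht hv₁ hv₂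
  have hPe := combination_eq_or_eq (s := s) hu hu₁ hu₂
  have hQe := combination_eq_or_eq (s := t) hv hv₁ hv₂
  -- The average of the four bounds with the product weights; each bound is affine in `u` and in `v`
  -- once the norms are fixed.
  have main : D ^ 2 + ‖d‖ ^ 2 - 2 * ⟪(1 - s) • u₁ + s • u₂, (1 - t) • v₁ + t • v₂⟫ -
      2 * ⟪(1 - s) • u₁ + s • u₂, d⟫ + 2 * ⟪(1 - t) • v₁ + t • v₂, d⟫ ≤ 0 := by
    simp only [inner_add_left, inner_add_right, real_inner_smul_left, real_inner_smul_right]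
    linarith
  set P := (1 - s) • u₁ + s • u₂ with hP
  set Q := (1 - t) • v₁ + t • v₂ with hQ
  have hr : 0 < ‖P‖ := norm_pos_iff.2 h0
  have hPQ : ‖P‖ = l * ‖Q‖ := by rw [heq, norm_neg, norm_smul, Real.norm_of_nonneg hl.le]
  have e1 : l * ⟪P, Q⟫ = -‖P‖ ^ 2 := by
    rw [← real_inner_self_eq_norm_sq]
    nth_rw 3 [heq]
    rw [inner_neg_right, real_inner_smul_right, neg_neg]
  have e2 : l * ⟪Q, d⟫ = -⟪P, d⟫ := by
    rw [heq, inner_neg_left, real_inner_smul_left, neg_neg]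
  have main2 : l * (D ^ 2 + ‖d‖ ^ 2) + 2 * ‖P‖ ^ 2 ≤ 2 * (1 + l) * ⟪P, d⟫ := by
    have := mul_nonneg hl.le (neg_nonneg.2 main)
    linarith
  have hcs := real_inner_le_norm P d
  have hc0 : 0 ≤ l * D - ‖P‖ := by
    rw [hPQ, ← mul_sub]; exact mul_nonneg hl.le (sub_nonneg.2 hQn)
  -- The slacks of `‖P‖ ≤ D` and, scaled by `l`, of `‖Q‖ ≤ D`. In these variables Cauchy–Schwarz
  -- turns the bound into a sum of nonnegative terms that is at most zero, so every term vanishes.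
  obtain ⟨a, ha⟩ : ∃ a, a = D - ‖P‖ := ⟨_, rfl⟩
  obtain ⟨c, hc⟩ : ∃ c, c = l * D - ‖P‖ := ⟨_, rfl⟩
  have ha0 : 0 ≤ a := by linarith
  rw [← hc] at hc0
  set r := ‖P‖ with hr'
  set τ := ‖d‖ with hτ
  have hDe : D = r + a := by linarith
  have hlD : l * D = r + c := by linarith
  have main3 : (r + a) * (r + c) * (D ^ 2 + τ ^ 2) + 2 * r ^ 2 * D ^ 2 ≤
      2 * D * (2 * r + a + c) * ⟪P, d⟫ := by
    have := mul_le_mul_of_nonneg_left main2 (sq_nonneg D)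
    calc _ = D ^ 2 * (l * (D ^ 2 + τ ^ 2) + 2 * r ^ 2) := by rw [← hDe, ← hlD]; ring
      _ ≤ _ := this
      _ = 2 * D * (D + l * D) * ⟪P, d⟫ := by ring
      _ = 2 * D * (2 * r + a + c) * ⟪P, d⟫ := by
        rw [show D + l * D = 2 * r + a + c by linarith]
  have hτ0 : 0 ≤ τ := norm_nonneg d
  have hk : 0 < 2 * D * (2 * r + a + c) := by positivity
  have main4 : r ^ 2 * ((D - τ) * (3 * D - τ)) + r * (a + c) * (D - τ) ^ 2 +
      a * c * (D ^ 2 + τ ^ 2) ≤ 0 := by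
    have := mul_le_mul_of_nonneg_left hcs hk.le
    linarith
  have n1 : 0 ≤ (D - τ) * (3 * D - τ) := mul_nonneg (by linarith) (by linarith)
  have n2 : 0 ≤ r * (a + c) * (D - τ) ^ 2 := by positivity
  have n3 : 0 ≤ a * c * (D ^ 2 + τ ^ 2) := by positivity
  have n4 : 0 ≤ r ^ 2 * ((D - τ) * (3 * D - τ)) := by positivity
  have z1 : r ^ 2 * ((D - τ) * (3 * D - τ)) = 0 := by linarith
  have z3 : a * c * (D ^ 2 + τ ^ 2) = 0 := by linarith
  have hτD : τ = D := by
    rcases mul_eq_zero.1 z1 with h | h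
    · exact absurd h (by positivity)
    · rcases mul_eq_zero.1 h with h | h <;> linarith
  have hac : a * c = 0 := (mul_eq_zero.1 z3).resolve_right (by positivity)
  have hin : D * r ≤ ⟪P, d⟫ := by
    refine le_of_mul_le_mul_left ?_ hk
    calc _ = (r + a) * (r + c) * (D ^ 2 + τ ^ 2) + 2 * r ^ 2 * D ^ 2 - a * c * (2 * D ^ 2) := by
          rw [hτD]; ring
      _ ≤ _ := by rw [hac]; linarith
  -- One of `P`, `Q` has full length `D`, so it is an endpoint of its chord, and equality in
  -- Cauchy–Schwarz identifies `P` or `-Q` with `d`.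
  rcases mul_eq_zero.1 hac with h | h
  · have hrD : r = D := by linarith
    have hPd : P = d := eq_of_norm_of_le_inner hrD hτD (by rw [sq]; nth_rw 2 [← hrD]; exact hin)
    rcases hPe hrD with h' | h'
    · exact hu₁d (h' ▸ hPd)
    · exact hu₂d (h' ▸ hPd)
  · have hQD : ‖Q‖ = D := by
      apply mul_left_cancel₀ hl.ne'
      linarith
    have hQd : -Q = d := by
      apply eq_of_norm_of_le_inner (by rw [norm_neg, hQD]) hτD
      rw [inner_neg_left]
      refine le_of_mul_le_mul_left ?_ hl
      rw [mul_neg, e2, neg_neg]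
      refine le_trans (le_of_eq ?_) hin
      rw [hPQ, hQD]; ring
    rcases hQe hQD with h' | h'
    · exact hv₁d (h' ▸ hQd)
    · exact hv₂d (h' ▸ hQd)
end

theorem exists_eq_smul_of_crossProduct_eq_zero {p q : Fin 3 → ℝ} (hp : p ≠ 0) (hq : q ≠ 0)
    (h : crossProduct p q = 0) : ∃ l : ℝ, l ≠ 0 ∧ p = l • q := by
  rw [← Projectivization.mk_eq_mk_iff_crossProduct_eq_zero hp hq,
    Projectivization.mk_eq_mk_iff'] at h
  obtain ⟨l, hl⟩ := h
  refine ⟨l, ?_, hl.symm⟩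
  rintro rfl
  exact hp (by rw [← hl, zero_smul])

-- Parallel vectors of the two cones point either the same way, contradicting their signs against `x
-- - y`, or opposite ways, which is `combination_ne_neg_smul` with `d = y - x`.
open scoped RealInnerProductSpace in
theorem crossProduct_combination_ne_zero {S : Set (EuclideanSpace ℝ (Fin 3))} {D s t : ℝ}
    (hD : 0 < D) (hS : ∀ P ∈ S, ∀ Q ∈ S, dist P Q ≤ D)
    (hs : s ∈ Set.Icc (0 : ℝ) 1) (ht : t ∈ Set.Icc (0 : ℝ) 1)
    {x x₁ x₂ y y₁ y₂ : EuclideanSpace ℝ (Fin 3)} (hx : x ∈ S) (hx₁ : x₁ ∈ S) (hx₂ : x₂ ∈ S)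
    (hy : y ∈ S) (hy₁ : y₁ ∈ S) (hy₂ : y₂ ∈ S) (dx₁ : dist x₁ x = D) (dx₂ : dist x₂ x = D)
    (dy₁ : dist y₁ y = D) (dy₂ : dist y₂ y = D) (nx : x₁ ≠ x₂) (ny : y₁ ≠ y₂) (hxy : x ≠ y)
    (hx₁y : x₁ ≠ y) (hx₂y : x₂ ≠ y) (hxy₁ : x ≠ y₁) (hxy₂ : x ≠ y₂) :
    crossProduct (WithLp.ofLp ((1 - s) • (x₁ - x) + s • (x₂ - x)))
      (WithLp.ofLp ((1 - t) • (y₁ - y) + t • (y₂ - y))) ≠ 0 := by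
  intro h
  have iP := inner_combination_neg hs (inner_sub_neg_of_dist_le hxy dx₁ (hS _ hx₁ _ hy))
    (inner_sub_neg_of_dist_le hxy dx₂ (hS _ hx₂ _ hy))
  have iQ := inner_combination_neg ht (inner_sub_neg_of_dist_le hxy.symm dy₁ (hS _ hy₁ _ hx))
    (inner_sub_neg_of_dist_le hxy.symm dy₂ (hS _ hy₂ _ hx))
  have hP0 : (1 - s) • (x₁ - x) + s • (x₂ - x) ≠ 0 := by
    intro h0; rw [h0, inner_zero_left] at iP; exact iP.false
  have hQ0 : (1 - t) • (y₁ - y) + t • (y₂ - y) ≠ 0 := by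
    intro h0; rw [h0, inner_zero_left] at iQ; exact iQ.false
  obtain ⟨l, hl, hPQ⟩ := exists_eq_smul_of_crossProduct_eq_zero
    (fun h0 => hP0 (WithLp.ofLp_injective 2 h0)) (fun h0 => hQ0 (WithLp.ofLp_injective 2 h0)) h
  have hPQ : (1 - s) • (x₁ - x) + s • (x₂ - x) = l • ((1 - t) • (y₁ - y) + t • (y₂ - y)) :=
    WithLp.ofLp_injective 2 hPQ
  rcases lt_or_gt_of_ne hl with hl | hl
  · have key (p q : EuclideanSpace ℝ (Fin 3)) (hp : p ∈ S) (hq : q ∈ S) :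
        ‖(p - x) - (q - y) - (y - x)‖ ≤ D := by
      rw [show (p - x) - (q - y) - (y - x) = p - q by abel, ← dist_eq_norm]
      exact hS p hp q hq
    refine combination_ne_neg_smul (d := y - x) hD hs ht (neg_pos.2 hl) (dist_eq_norm x₁ x ▸ dx₁)
      (dist_eq_norm x₂ x ▸ dx₂) (dist_eq_norm y₁ y ▸ dy₁) (dist_eq_norm y₂ y ▸ dy₂)
      (dist_eq_norm y x ▸ hS y hy x hx) (key _ _ hx₁ hy₁) (key _ _ hx₁ hy₂) (key _ _ hx₂ hy₁)
      (key _ _ hx₂ hy₂) (fun e => nx (sub_left_injective e)) (fun e => ny (sub_left_injective e))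
      (fun e => hx₁y (sub_left_injective e)) (fun e => hx₂y (sub_left_injective e)) ?_ ?_ hP0
      (by rw [hPQ, neg_smul, neg_neg])
    · rw [neg_sub]; exact fun e => hxy₁ (sub_right_injective e).symm
    · rw [neg_sub]; exact fun e => hxy₂ (sub_right_injective e).symm
  · rw [hPQ, real_inner_smul_left, ← neg_sub y x, inner_neg_right] at iP
    nlinarith [mul_neg_of_pos_of_neg hl iQ]

-- Odd cycles as antipodal polygons.

/-- Two closed sequences of odd periods of points of a set of diameter `D`, with all steps of
length `D` and no immediate return, have a common point. -/
theorem exists_eq_of_odd_closed_sequences {S : Set (EuclideanSpace ℝ (Fin 3))} {D : ℝ}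
    (hD : 0 < D) (hS : ∀ P ∈ S, ∀ Q ∈ S, dist P Q ≤ D) {N M : ℕ} (hN : Odd N) (hM : Odd M)
    (hN1 : 1 < N) (hM1 : 1 < M) (x y : ℕ → EuclideanSpace ℝ (Fin 3))
    (hx : ∀ i, x i ∈ S) (hy : ∀ i, y i ∈ S) (px : ∀ i, x (i + N) = x i)
    (py : ∀ i, y (i + M) = y i) (dx : ∀ i, dist (x i) (x (i + 1)) = D)
    (dy : ∀ i, dist (y i) (y (i + 1)) = D) (nx : ∀ i, x i ≠ x (i + 2))
    (ny : ∀ i, y i ≠ y (i + 2)) : ∃ i j, x i = y j := by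
  by_contra! hne
  have closes {z : ℕ → EuclideanSpace ℝ (Fin 3)} {K : ℕ} (hK : Odd K) (pz : ∀ i, z (i + K) = z i) :
      (-1 : ℝ) ^ K • WithLp.ofLp (z (K + 1) - z K) =
      -((-1 : ℝ) ^ 0 • WithLp.ofLp (z (0 + 1) - z 0)) := by
    have h0 := pz 0
    have h1 := pz 1
    rw [zero_add] at h0
    rw [add_comm] at h1
    rw [hK.neg_one_pow, h0, h1]; simp
  -- The alternating sign makes the arc between consecutive directions run, up to sign, inside the
  -- cone at the common vertex `z (i + 1)`.
  have arc (z : ℕ → EuclideanSpace ℝ (Fin 3)) (i : ℕ) (s : ℝ) :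
      (1 - s) • ((-1 : ℝ) ^ i • WithLp.ofLp (z (i + 1) - z i)) +
        s • ((-1 : ℝ) ^ (i + 1) • WithLp.ofLp (z (i + 1 + 1) - z (i + 1))) =
      (-1 : ℝ) ^ (i + 1) •
        WithLp.ofLp ((1 - s) • (z i - z (i + 1)) + s • (z (i + 2) - z (i + 1))) := by
    ext k
    simp [pow_succ]
    ring
  obtain ⟨n, rfl⟩ : ∃ n, N = n + 1 := ⟨N - 1, by omega⟩
  obtain ⟨i, -, j, -, s, hs, t, ht, h⟩ := exists_crossProduct_eq_zero_of_antipodal n M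
    (fun i => (-1 : ℝ) ^ i • WithLp.ofLp (x (i + 1) - x i))
    (fun i => (-1 : ℝ) ^ i • WithLp.ofLp (y (i + 1) - y i)) (by omega) hM1
    (closes hN px) (closes hM py)
  simp only [] at h
  rw [arc, arc, LinearMap.map_smul, LinearMap.map_smul, LinearMap.smul_apply] at h
  have hu (k : ℕ) : (-1 : ℝ) ^ k ≠ 0 := pow_ne_zero k (by norm_num)
  have h := (smul_eq_zero.1 ((smul_eq_zero.1 h).resolve_left (hu _))).resolve_left (hu _)
  exact crossProduct_combination_ne_zero hD hS hs ht (hx (i + 1)) (hx i) (hx (i + 2))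
    (hy (j + 1)) (hy j) (hy (j + 2)) (dx i) (dist_comm (x (i + 2)) (x (i + 1)) ▸ dx (i + 1)) (dy j)
    (dist_comm (y (j + 2)) (y (j + 1)) ▸ dy (j + 1)) (nx i) (ny j) (hne _ _) (hne _ _) (hne _ _)
    (hne _ _) (hne _ _) h

theorem SimpleGraph.Walk.IsCycle.exists_periodic {V : Type*} {G : SimpleGraph V} {u : V}
    {p : G.Walk u u} (hp : p.IsCycle) :
    ∃ x : ℕ → V, (∀ i, x i ∈ p.support) ∧ (∀ i, x (i + p.length) = x i) ∧
      (∀ i, G.Adj (x i) (x (i + 1))) ∧ ∀ i, x i ≠ x (i + 2) := by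
  have h3 := hp.three_le_length
  refine ⟨fun i => p.getVert (i % p.length), fun i => p.getVert_mem_support _, fun i => by simp,
    fun i => ?_, fun i h => ?_⟩
  · have hlt := Nat.mod_lt i (show 0 < p.length by omega)
    have hadj := p.adj_getVert_succ hlt
    have hmod : (i + 1) % p.length = (i % p.length + 1) % p.length := by simp
    rcases (Nat.succ_le_of_lt hlt).lt_or_eq with h | h
    · simp only [hmod, Nat.mod_eq_of_lt h]
      exact hadj
    · rw [Nat.succ_eq_add_one] at h
      simp only [hmod, h, Nat.mod_self, p.getVert_zero]
      rw [h, p.getVert_length] at hadj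
      exact hadj
  · have hlt := Nat.mod_lt i (show 0 < p.length by omega)
    have hlt' := Nat.mod_lt (i + 2) (show 0 < p.length by omega)
    have heq := hp.getVert_injOn' (by rw [Set.mem_ofPred_eq]; omega)
      (by rw [Set.mem_ofPred_eq]; omega) h
    -- An immediate return would make the length divide 2, but a cycle has length at least 3.
    have : i + 0 ≡ i + 2 [MOD p.length] := heq
    have := Nat.ModEq.add_left_cancel' i this
    have hd := (Nat.modEq_iff_dvd' (by omega)).1 this
    have := Nat.le_of_dvd (by omega) hd
    omega

/-- Two odd cycles of a diameter graph in `ℝ³` have a common vertex. -/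
theorem not_disjoint_support_of_odd_cycles (X : Set (EuclideanSpace ℝ (Fin 3))) {u v : X}
    {p : (diameterGraph X).Walk u u} {q : (diameterGraph X).Walk v v} (hp : p.IsCycle)
    (hq : q.IsCycle) (hpo : Odd p.length) (hqo : Odd q.length) :
    ¬ List.Disjoint p.support q.support := by
  intro hdisj
  obtain ⟨x, hxs, hxp, hxa, hxn⟩ := hp.exists_periodic
  obtain ⟨y, hys, hyp, hya, hyn⟩ := hq.exists_periodic
  have hD : IsDiameter X (dist (x 0) (x 1)) := (hxa 0).2
  have hpos : 0 < dist (x 0) (x 1) := dist_pos.2 (hxa 0).1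
  obtain ⟨i, j, hij⟩ := exists_eq_of_odd_closed_sequences (S := X) hpos
    (fun P hP Q hQ => by
      by_cases h : P = Q
      · rw [h, dist_self]; exact hpos.le
      · exact hD.2 ⟨P, hP, Q, hQ, h, rfl⟩)
    hpo hqo (by have := hp.three_le_length; omega) (by have := hq.three_le_length; omega)
    (fun i => (x i : EuclideanSpace ℝ (Fin 3))) (fun i => (y i : EuclideanSpace ℝ (Fin 3)))
    (fun i => (x i).2) (fun i => (y i).2) (fun i => congrArg _ (hxp i))
    (fun i => congrArg _ (hyp i)) (fun i => (hxa i).2.unique hD) (fun i => (hya i).2.unique hD)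
    (fun i h => hxn i (Subtype.ext h)) (fun i h => hyn i (Subtype.ext h))
  exact hdisj (hxs i) (Subtype.ext hij ▸ hys j)

theorem corollary3p2 (X : Set (EuclideanSpace ℝ (Fin 3))) :
    ¬ ∃ (u v : X) (p : (diameterGraph X).Walk u u) (q : (diameterGraph X).Walk v v),
      p.IsCycle ∧ p.length = 5 ∧ q.IsCycle ∧ q.length = 5 ∧
        List.Disjoint p.support q.support := by
  rintro ⟨u, v, p, q, hp, hpl, hq, hql, hd⟩
  exact not_disjoint_support_of_odd_cycles X hp hq (by rw [hpl]; decide) (by rw [hql]; decide) hd
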